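/- Let $K$ be a field. For a finite group $\Gamma$, let $\Gamma$ act on the rational function field $K(x(g):g\in\Gamma)$ by $K$-automorphisms via $h\cdot x(g)=x(hg)$ for all $g,h\in\Gamma$, and let $K(\Gamma)=K(x(g):g\in\Gamma)^{\Gamma}$ denote the fixed field. Let $\widetilde G=H\times G$ be a direct product of finite groups, where $H$ is abelian of exponent $e$, i.e. $e=\max\{\mathrm{ord}(h):h\in H\}$, and assume that $K$ contains a primitive $e$-th root of unity. Then there is an injective $K$-linear field homomorphism of $K(G)$ into $K(\widetilde G)$ such that $K(\widetilde G)$ is rational over (the image of) $K(G)$, that is, $K(\widetilde G)$ is generated as a field over $K(G)$ by finitely many elements that are algebraically independent over $K(G)$. -/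

import Mathlib

noncomputable section

/-- The rational function field `K(x(g) : g ∈ G)` in variables indexed by `G`. -/
abbrev RegularFunctionField (K : Type*) [Field K] (G : Type*) : Type _ :=
  FractionRing (MvPolynomial G K)

/-- The action of `G` on the polynomial ring by `K`-algebra automorphisms, `h • x(g) = x(h * g)`. -/
def polynomialTranslation (K : Type*) [Field K] (G : Type*) [Group G] :
    G →* (MvPolynomial G K ≃ₐ[K] MvPolynomial G K) where
  toFun h := MvPolynomial.renameEquiv K (Equiv.mulLeft h)
  map_one' := by
    ext p
    simp
  map_mul' h k := by
    ext p
    simp [MvPolynomial.rename_rename, Function.comp_def]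

/-- The action of `G` on `K(x(g) : g ∈ G)` by `K`-automorphisms, `h • x(g) = x(h * g)`. -/
def regularAction (K : Type*) [Field K] (G : Type*) [Group G] :
    G →* (RegularFunctionField K G ≃ₐ[K] RegularFunctionField K G) :=
  (IsFractionRing.fieldEquivOfAlgEquivHom K (RegularFunctionField K G)).comp
    (polynomialTranslation K G)

theorem regularAction_X (K : Type*) [Field K] (G : Type*) [Group G] (h g : G) :
    regularAction K G h (algebraMap (MvPolynomial G K) _ (MvPolynomial.X g)) =
      algebraMap (MvPolynomial G K) _ (MvPolynomial.X (h * g)) := by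
  simp [regularAction, polynomialTranslation]

/-- The fixed field `K(G) = K(x(g) : g ∈ G)^G`. -/
def noetherField (K : Type*) [Field K] (G : Type*) [Group G] :
    IntermediateField K (RegularFunctionField K G) :=
  IntermediateField.fixedField (regularAction K G).range

theorem mem_noetherField_iff (K : Type*) [Field K] (G : Type*) [Group G]
    (f : RegularFunctionField K G) :
    f ∈ noetherField K G ↔ ∀ h : G, regularAction K G h f = f := by
  simp [noetherField, IntermediateField.mem_fixedField_iff]

/-- For a homomorphism of fields `φ : F → L`, the field `L` is rational (purely transcendental,
of finite transcendence degree) over `F` along `φ`: `L = F(x₁, …, xₙ)` for finitely many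
elements that are algebraically independent over `F`. -/
def IsRationalAlong {F L : Type*} [Field F] [Field L] (φ : F →+* L) : Prop :=
  letI : Algebra F L := φ.toAlgebra
  ∃ (n : ℕ) (x : Fin n → L),
    AlgebraicIndependent F x ∧ IntermediateField.adjoin F (Set.range x) = ⊤

end

/-! Fourier analysis on `H` replaces the variables x(h, g) by forms y_χ(g), one for each character χ
and each g, on which (h, k) acts by y_χ(g) ↦ χ(h) y_χ(kg). The forms y_1(g) are a copy of the
variables for `G`. For χ ≠ 1 the y_χ(g) give way to w_{χ,i} = ∑_g y_χ(g) y_1(g)^i, which `G` fixes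
and `H` scales by χ; interpolation at the distinct nodes y_1(g) recovers the y_χ(g). Now `G` moves
only the y_1(g) and `H` only the w_{χ,i}. Laurent monomials in the w_{χ,i} fixed by `H` have
exponents in a subgroup of ℤ^N, and the monomials of a ℤ-basis of it are the required generators
over K(G).

They generate by a trace argument (`noetherField_le`): the whole field is spanned by products of a
function of the y_1(g) and a monomial, and the trace sends each product into the subfield generated.
They are independent by counting (`algebraicIndependent_sumElim`): together with the y_1(g) they
number at most |H × G|, and all variables are algebraic over them. -/

open MvPolynomial

noncomputable section

/-! ### Generation and independence in rational function fields -/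

/-- The variable `x(g)` as an element of the rational function field. -/
def ratVar (K : Type*) [Field K] {Γ : Type*} (γ : Γ) : RegularFunctionField K Γ :=
  algebraMap (MvPolynomial Γ K) _ (X γ)

theorem regularAction_ratVar (K : Type*) [Field K] {Γ : Type*} [Group Γ] (h g : Γ) :
    regularAction K Γ h (ratVar K g) = ratVar K (h * g) :=
  regularAction_X K Γ h g

theorem isTranscendenceBasis_ratVar (K : Type*) [Field K] (Γ : Type*) :
    IsTranscendenceBasis K (ratVar K : Γ → RegularFunctionField K Γ) :=
  have : Algebra.IsAlgebraic (MvPolynomial Γ K) (RegularFunctionField K Γ) :=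
    IsLocalization.isAlgebraic _ (nonZeroDivisors (MvPolynomial Γ K))
  (IsTranscendenceBasis.mvPolynomial Γ K).algebraMap_comp (A := RegularFunctionField K Γ)

theorem regularFunctionField_induction {K : Type*} [Field K] {Γ : Type*}
    (S : IntermediateField K (RegularFunctionField K Γ)) (h : ∀ γ, ratVar K γ ∈ S) : S = ⊤ := by
  rw [eq_top_iff]
  rintro f -
  have hp (p : MvPolynomial Γ K) : algebraMap _ (RegularFunctionField K Γ) p ∈ S := by
    induction p using MvPolynomial.induction_on with
    | C a =>
      rw [← MvPolynomial.algebraMap_eq, ← IsScalarTower.algebraMap_apply]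
      exact S.algebraMap_mem a
    | add p q hp hq => rw [map_add]; exact add_mem hp hq
    | mul_X p n hp => rw [map_mul]; exact mul_mem hp (h n)
  obtain ⟨p, q, -, rfl⟩ := IsFractionRing.div_surjective (MvPolynomial Γ K) f
  exact div_mem (hp p) (hp q)

theorem algHom_ext_ratVar {K : Type*} [Field K] {Γ : Type*} {L : Type*} [Field L] [Algebra K L]
    {f g : RegularFunctionField K Γ →ₐ[K] L} (h : ∀ γ, f (ratVar K γ) = g (ratVar K γ)) :
    f = g := by
  let E : IntermediateField K (RegularFunctionField K Γ) :=
    { AlgHom.equalizer f g with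
      inv_mem' := fun x (hx : f x = g x) => show f x⁻¹ = g x⁻¹ by rw [map_inv₀, map_inv₀, hx] }
  have hE : E = ⊤ := regularFunctionField_induction E h
  refine AlgHom.ext fun x => ?_
  have hx : x ∈ E := hE ▸ IntermediateField.mem_top
  exact hx

/-- A family of at most `|Γ|` elements over which the rational function field is algebraic is
algebraically independent. -/
theorem algebraicIndependent_of_card_le.{u, v, w} {K : Type u} [Field K] {Γ : Type v} {ι : Type w} [Finite Γ]
    [Finite ι] (x : ι → RegularFunctionField K Γ) (hcard : Nat.card ι ≤ Nat.card Γ)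
    (halg : ∀ γ : Γ, IsAlgebraic (IntermediateField.adjoin K (Set.range x)) (ratVar K γ)) :
    AlgebraicIndependent K x := by
  have hS : Algebra.IsAlgebraic (IntermediateField.adjoin K (Set.range x))
      (RegularFunctionField K Γ) := by
    have := regularFunctionField_induction
      (((algebraicClosure (IntermediateField.adjoin K (Set.range x))
        (RegularFunctionField K Γ))).restrictScalars K)
      (fun γ => by
        rw [IntermediateField.mem_restrictScalars, mem_algebraicClosure_iff]
        exact halg γ)
    refine ⟨fun f => ?_⟩
    rw [← mem_algebraicClosure_iff, ← IntermediateField.mem_restrictScalars K, this]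
    trivial
  have : Algebra.IsAlgebraic (Algebra.adjoin K (Set.range x)) (RegularFunctionField K Γ) :=
    IntermediateField.isAlgebraic_adjoin_iff_top.mp hS
  refine (Algebra.IsAlgebraic.isTranscendenceBasis_of_lift_le_trdeg_of_finite K x ?_).1
  have h := (isTranscendenceBasis_ratVar K Γ).lift_cardinalMk_eq_trdeg
  rw [← Nat.cast_card, Cardinal.lift_natCast, eq_comm, Cardinal.lift_eq_nat_iff] at h
  rw [h, ← Nat.cast_card, Cardinal.lift_natCast, Cardinal.lift_natCast]
  exact_mod_cast hcard

/-- Polynomial interpolation: a family indexed by distinct nodes is recovered linearly from its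
power sums weighted by the nodes. -/
theorem exists_interpolation {F G : Type*} [Field F] [Fintype G] (θ : G → F)
    (hθ : Function.Injective θ) :
    ∃ c : G → Fin (Fintype.card G) → F, ∀ (L : Type*) [Field L] [Algebra F L] (y : G → L) (j : G),
      y j = ∑ i, algebraMap F L (c j i) * ∑ g, y g * algebraMap F L (θ g) ^ (i : ℕ) := by
  classical
  -- The coefficients of the Lagrange basis polynomials form the inverse of the Vandermonde matrix
  -- of the nodes.
  refine ⟨fun j i => (Lagrange.basis Finset.univ θ j).coeff i, fun L _ _ y j => ?_⟩
  have hdeg (j : G) : (Lagrange.basis Finset.univ θ j).natDegree < Fintype.card G := by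
    have : Nonempty G := ⟨j⟩
    rw [Lagrange.natDegree_basis hθ.injOn (Finset.mem_univ j), Finset.card_univ]
    exact Nat.sub_lt Fintype.card_pos one_pos
  have heval (g : G) : ∑ i : Fin (Fintype.card G),
      (Lagrange.basis Finset.univ θ j).coeff i * θ g ^ (i : ℕ) = if g = j then 1 else 0 := by
    rw [Fin.sum_univ_eq_sum_range
      (fun i => (Lagrange.basis Finset.univ θ j).coeff i * θ g ^ i),
      ← Polynomial.eval_eq_sum_range' (hdeg j)]
    split_ifs with h
    · rw [h, Lagrange.eval_basis_self hθ.injOn (Finset.mem_univ j)]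
    · exact Lagrange.eval_basis_of_ne (Ne.symm h) (Finset.mem_univ g)
  simp_rw [Finset.mul_sum]
  rw [Finset.sum_comm]
  have (g : G) : ∑ i : Fin (Fintype.card G), algebraMap F L
      ((Lagrange.basis Finset.univ θ j).coeff i) * (y g * algebraMap F L (θ g) ^ (i : ℕ)) =
      y g * algebraMap F L (if g = j then 1 else 0) := by
    rw [← heval, map_sum, Finset.mul_sum]
    exact Finset.sum_congr rfl fun i _ => by rw [map_mul, map_pow]; ring
  simp [this]

/-! ### Characters of `H` -/

/-- A primitive root of order `Monoid.exponent H` makes the exponent nonzero in `K`, and by Cauchy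
every prime dividing |H| divides the exponent. -/
theorem natCast_card_ne_zero {K : Type*} [Field K] (H : Type*) [Group H] [Finite H]
    (hK : ∃ ζ : K, IsPrimitiveRoot ζ (Monoid.exponent H)) : (Nat.card H : K) ≠ 0 := by
  obtain ⟨ζ, hζ⟩ := hK
  have : NeZero (Monoid.exponent H) := ⟨Monoid.exponent_ne_zero_of_finite⟩
  have hne := hζ.neZero'.out
  intro h0
  obtain ⟨p, hp⟩ := CharP.exists K
  rw [CharP.cast_eq_zero_iff K p] at h0
  rcases CharP.char_is_prime_or_zero K p with hp' | rfl
  · have : Fact p.Prime := ⟨hp'⟩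
    obtain ⟨x, hx⟩ := exists_prime_orderOf_dvd_card' p h0
    exact hne ((CharP.cast_eq_zero_iff K p _).mpr (hx ▸ Monoid.order_dvd_exponent x))
  · exact Nat.card_pos.ne' (Nat.eq_zero_of_zero_dvd h0)

theorem hasEnoughRootsOfUnity_exponent {K : Type*} [Field K] (H : Type*) [Group H] [Finite H]
    (hK : ∃ ζ : K, IsPrimitiveRoot ζ (Monoid.exponent H)) :
    HasEnoughRootsOfUnity K (Monoid.exponent H) := by
  have : NeZero (Monoid.exponent H) := ⟨Monoid.exponent_ne_zero_of_finite⟩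
  exact ⟨hK, inferInstance⟩

/-- The columns of a character table are orthogonal. -/
theorem sum_monoidHom_apply_eq_zero {K : Type*} [Field K] {H : Type*} [CommGroup H] [Finite H]
    [HasEnoughRootsOfUnity K (Monoid.exponent H)] [Fintype (H →* Kˣ)] {h : H} (hh : h ≠ 1) :
    ∑ χ : H →* Kˣ, (χ h : K) = 0 := by
  obtain ⟨ψ, hψ⟩ := CommGroup.exists_apply_ne_one_of_hasEnoughRootsOfUnity H K hh
  have : (ψ h : K) * ∑ χ : H →* Kˣ, (χ h : K) = ∑ χ : H →* Kˣ, (χ h : K) := by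
    rw [Finset.mul_sum]
    exact Fintype.sum_equiv (Equiv.mulLeft ψ) _ _ fun χ => by simp
  by_contra h0
  exact hψ (Units.ext (mul_right_cancel₀ h0 (this.trans (one_mul _).symm)))

theorem sum_character_eq_zero {K : Type*} [Field K] {H : Type*} [Group H] [Fintype H]
    {χ : H →* Kˣ} (hχ : χ ≠ 1) : ∑ h, (χ h : K) = 0 := by
  refine sum_hom_units_eq_zero ((Units.coeHom K).comp χ) fun h => hχ ?_
  ext x
  simpa using DFunLike.congr_fun h x

end

noncomputable section

theorem isAlgebraic_of_mem {K L : Type*} [Field K] [Field L] [Algebra K L] {S : IntermediateField K L} {x : L}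
    (hx : x ∈ S) : IsAlgebraic S x :=
  isAlgebraic_algebraMap (⟨x, hx⟩ : S)

variable {K : Type*} [Field K] {H : Type*} [CommGroup H] [Fintype H] {G : Type*}

/-! ### Isotypic coordinates -/

/-- The projection of `x(1, g)` to the `χ`-isotypic part of the span of the variables, up to the
factor `|H|`. -/
def isotypicVar (χ : H →* Kˣ) (g : G) : RegularFunctionField K (H × G) :=
  ∑ h, algebraMap K _ ((χ h)⁻¹ : Kˣ) * ratVar K (h, g)

/-- Fourier inversion, from the orthogonality of the columns of the character table. -/
theorem ratVar_eq_sum_isotypicVar [HasEnoughRootsOfUnity K (Monoid.exponent H)]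
    [Fintype (H →* Kˣ)] (hH : (Nat.card H : K) ≠ 0) (h : H) (g : G) :
    ratVar K (h, g) = algebraMap K _ (Nat.card H : K)⁻¹ *
      ∑ χ : H →* Kˣ, algebraMap K _ (χ h) * isotypicVar χ g := by
  classical
  have key (h' : H) : ∑ χ : H →* Kˣ, (χ h : K) * ((χ h')⁻¹ : Kˣ) =
      if h' = h then (Nat.card H : K) else 0 := by
    split_ifs with hh
    · simp [hh, ← Nat.card_eq_fintype_card, CommGroup.card_monoidHom_of_hasEnoughRootsOfUnity]
    · rw [← sum_monoidHom_apply_eq_zero (K := K) (h := h * h'⁻¹)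
        (fun e => hh (mul_inv_eq_one.mp e).symm)]
      simp
  simp only [isotypicVar, Finset.mul_sum]
  rw [Finset.sum_comm]
  simp only [← mul_assoc, ← map_mul, ← Finset.sum_mul, ← map_sum]
  simp only [mul_assoc, ← Finset.mul_sum, key]
  rw [Finset.sum_eq_single h (fun h' _ hne => by simp [hne]) (by simp)]
  rw [if_pos rfl, inv_mul_cancel₀ hH, map_one, one_mul]

theorem eq_top_of_isotypicVar_mem [HasEnoughRootsOfUnity K (Monoid.exponent H)]
    (hH : (Nat.card H : K) ≠ 0) (S : IntermediateField K (RegularFunctionField K (H × G)))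
    (hS : ∀ (χ : H →* Kˣ) (g : G), isotypicVar χ g ∈ S) : S = ⊤ := by
  have : Finite (H →* Kˣ) := Nat.finite_of_card_ne_zero
    (CommGroup.card_monoidHom_of_hasEnoughRootsOfUnity H K ▸ Nat.card_pos.ne')
  cases nonempty_fintype (H →* Kˣ)
  refine regularFunctionField_induction S fun ⟨h, g⟩ => ?_
  rw [ratVar_eq_sum_isotypicVar hH]
  exact mul_mem (S.algebraMap_mem _)
    (sum_mem fun χ _ => mul_mem (S.algebraMap_mem _) (hS χ g))

theorem algebraicIndependent_of_isAlgebraic_isotypicVar {ι : Type*} [Finite ι] [Finite G]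
    [HasEnoughRootsOfUnity K (Monoid.exponent H)] (hH : (Nat.card H : K) ≠ 0)
    (x : ι → RegularFunctionField K (H × G)) (hcard : Nat.card ι ≤ Nat.card (H × G))
    (halg : ∀ (χ : H →* Kˣ) (g : G),
      IsAlgebraic (IntermediateField.adjoin K (Set.range x)) (isotypicVar χ g)) :
    AlgebraicIndependent K x := by
  refine algebraicIndependent_of_card_le x hcard fun γ => ?_
  have := eq_top_of_isotypicVar_mem hH
    ((algebraicClosure (IntermediateField.adjoin K (Set.range x))
      (RegularFunctionField K (H × G))).restrictScalars K)
    (fun χ g => by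
      rw [IntermediateField.mem_restrictScalars, mem_algebraicClosure_iff]
      exact halg χ g)
  rw [← mem_algebraicClosure_iff, ← IntermediateField.mem_restrictScalars K, this]
  trivial

/-- `H` has exactly |H| characters with values in `K`, so there are as many forms as variables. -/
theorem algebraicIndependent_isotypicVar [Finite G]
    [HasEnoughRootsOfUnity K (Monoid.exponent H)] (hH : (Nat.card H : K) ≠ 0) :
    AlgebraicIndependent K fun p : (H →* Kˣ) × G => isotypicVar p.1 p.2 := by
  have : Finite (H →* Kˣ) := Nat.finite_of_card_ne_zero
    (CommGroup.card_monoidHom_of_hasEnoughRootsOfUnity H K ▸ Nat.card_pos.ne')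
  refine algebraicIndependent_of_isAlgebraic_isotypicVar hH _ ?_ fun χ g =>
    isAlgebraic_of_mem (IntermediateField.subset_adjoin _ _ ⟨(χ, g), rfl⟩)
  rw [Nat.card_prod, Nat.card_prod, CommGroup.card_monoidHom_of_hasEnoughRootsOfUnity]

theorem algebraicIndependent_isotypicVar_one [Finite G]
    [HasEnoughRootsOfUnity K (Monoid.exponent H)] (hH : (Nat.card H : K) ≠ 0) :
    AlgebraicIndependent K fun g : G => isotypicVar (1 : H →* Kˣ) g :=
  (algebraicIndependent_isotypicVar hH).comp (fun g => ((1 : H →* Kˣ), g))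
    (Prod.mk_right_injective _)

/-- The function field of `G` embeds as the field generated by the sums over the cosets of `H`. -/
theorem exists_algHom_isotypicVar_one [Finite G]
    [HasEnoughRootsOfUnity K (Monoid.exponent H)] (hH : (Nat.card H : K) ≠ 0) :
    ∃ φ : RegularFunctionField K G →ₐ[K] RegularFunctionField K (H × G),
      ∀ g, φ (ratVar K g) = isotypicVar 1 g := by
  have hinj : Function.Injective (aeval (R := K) fun g : G => isotypicVar (1 : H →* Kˣ) g) :=
    algebraicIndependent_isotypicVar_one hH
  refine ⟨IsFractionRing.liftAlgHom hinj, fun g => ?_⟩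
  rw [IsFractionRing.liftAlgHom_apply, ratVar, IsFractionRing.lift_algebraMap]
  exact aeval_X _ g

section

variable [Group G]

theorem regularAction_isotypicVar (χ : H →* Kˣ) (γ : H × G) (g : G) :
    regularAction K (H × G) γ (isotypicVar χ g) =
      algebraMap K _ (χ γ.1) * isotypicVar χ (γ.2 * g) := by
  simp only [isotypicVar, map_sum, map_mul, AlgEquiv.commutes, regularAction_ratVar,
    Finset.mul_sum]
  refine Fintype.sum_equiv (Equiv.mulLeft γ.1) _ _ fun h => ?_
  have hγ : algebraMap K (RegularFunctionField K (H × G)) (χ γ.1) ≠ 0 := by simp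
  simp only [Equiv.coe_mulLeft, map_mul, mul_inv, Units.val_mul, Units.val_inv_eq_inv_val,
    map_inv₀]
  rw [mul_assoc, mul_inv_cancel_left₀ hγ]
  rfl

/-- `H` acts trivially on the forms of trivial character, so `φ` is equivariant along the projection
to `G`. -/
theorem regularAction_algHom
    {φ : RegularFunctionField K G →ₐ[K] RegularFunctionField K (H × G)}
    (hφ : ∀ g, φ (ratVar K g) = isotypicVar 1 g) (γ : H × G) (a : RegularFunctionField K G) :
    regularAction K (H × G) γ (φ a) = φ (regularAction K G γ.2 a) := by
  have : ((regularAction K (H × G) γ : _ →ₐ[K] _).comp φ) =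
      φ.comp (regularAction K G γ.2 : _ →ₐ[K] _) := by
    refine algHom_ext_ratVar fun g => ?_
    simp [hφ, regularAction_isotypicVar, regularAction_ratVar]
  exact DFunLike.congr_fun this a

end

variable [Fintype G]

/-! ### Coordinates fixed by `G` -/

/-- The power sums of the `χ`-isotypic variables weighted by the invariant ones; they are
invariant under `G`. -/
def weightedPowerSum (χ : H →* Kˣ) (i : ℕ) : RegularFunctionField K (H × G) :=
  ∑ g, isotypicVar χ g * isotypicVar 1 g ^ i

/-- The nodes y_1(g) lie in `S`, hence so do the interpolation coefficients. -/
theorem isotypicVar_mem [HasEnoughRootsOfUnity K (Monoid.exponent H)]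
    (hH : (Nat.card H : K) ≠ 0) (S : IntermediateField K (RegularFunctionField K (H × G)))
    (h1 : ∀ g : G, isotypicVar (1 : H →* Kˣ) g ∈ S) (χ : H →* Kˣ)
    (hχ : ∀ i : Fin (Fintype.card G), weightedPowerSum χ i ∈ S) (g : G) :
    isotypicVar χ g ∈ S := by
  have hinj : Function.Injective fun g : G => (⟨_, h1 g⟩ : S) := fun a b hab =>
    (algebraicIndependent_isotypicVar_one hH).injective (congrArg Subtype.val hab)
  obtain ⟨c, hc⟩ := exists_interpolation _ hinj
  rw [hc _ (fun g => isotypicVar χ g) g]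
  exact sum_mem fun i _ => mul_mem (c g i).2 (hχ i)

/-- The nontrivial characters of `H`, each repeated `|G|` times. -/
abbrev WeightIndex (K : Type*) [Field K] (H : Type*) [CommGroup H] (G : Type*) [Fintype G] :
    Type _ :=
  {χ : H →* Kˣ // χ ≠ 1} × Fin (Fintype.card G)

/-- The `G`-invariant coordinates of nontrivial `H`-weight. -/
def weightCoord (p : WeightIndex K H G) : RegularFunctionField K (H × G) :=
  weightedPowerSum p.1.1 p.2

theorem eq_top_of_weightCoord_mem [HasEnoughRootsOfUnity K (Monoid.exponent H)]
    (hH : (Nat.card H : K) ≠ 0) (S : IntermediateField K (RegularFunctionField K (H × G)))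
    (h1 : ∀ g : G, isotypicVar (1 : H →* Kˣ) g ∈ S)
    (hS : ∀ p : WeightIndex K H G, weightCoord p ∈ S) : S = ⊤ := by
  refine eq_top_of_isotypicVar_mem hH S fun χ g => ?_
  by_cases hχ : χ = 1
  · subst hχ
    exact h1 g
  · exact isotypicVar_mem hH S h1 χ (fun i => hS (⟨χ, hχ⟩, i)) g

theorem card_weightIndex_add [HasEnoughRootsOfUnity K (Monoid.exponent H)] :
    Nat.card (WeightIndex K H G) + Nat.card G = Nat.card (H × G) := by
  classical
  have : Finite (H →* Kˣ) := Nat.finite_of_card_ne_zero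
    (CommGroup.card_monoidHom_of_hasEnoughRootsOfUnity H K ▸ Nat.card_pos.ne')
  cases nonempty_fintype (H →* Kˣ)
  have h1 : Nat.card {χ : H →* Kˣ // χ ≠ 1} + 1 = Nat.card H := by
    rw [← CommGroup.card_monoidHom_of_hasEnoughRootsOfUnity H K, Nat.card_eq_fintype_card,
      Nat.card_eq_fintype_card, Fintype.card_subtype_compl, Fintype.card_subtype_eq]
    exact Nat.sub_add_cancel Fintype.card_pos
  rw [Nat.card_prod, Nat.card_prod, ← h1, Nat.card_fin, Nat.card_eq_fintype_card (α := G)]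
  ring

theorem finite_weightIndex [HasEnoughRootsOfUnity K (Monoid.exponent H)] :
    Finite (WeightIndex K H G) := by
  have : Finite (H →* Kˣ) := Nat.finite_of_card_ne_zero
    (CommGroup.card_monoidHom_of_hasEnoughRootsOfUnity H K ▸ Nat.card_pos.ne')
  infer_instance

/-- A family of the right cardinality is algebraically independent as soon as the coordinates
are algebraic over it. -/
theorem algebraicIndependent_sumElim {ι : Type*} [Finite ι]
    [HasEnoughRootsOfUnity K (Monoid.exponent H)] (hH : (Nat.card H : K) ≠ 0)
    (w : ι → RegularFunctionField K (H × G)) (hcard : Nat.card ι ≤ Nat.card (WeightIndex K H G))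
    (halg : ∀ p : WeightIndex K H G, IsAlgebraic (IntermediateField.adjoin K (Set.range w))
      (weightCoord p)) :
    AlgebraicIndependent K (Sum.elim w fun g : G => isotypicVar (1 : H →* Kˣ) g) := by
  refine algebraicIndependent_of_isAlgebraic_isotypicVar hH _ ?_ fun χ g => ?_
  · rw [Nat.card_sum, ← card_weightIndex_add (K := K)]
    exact Nat.add_le_add_right hcard _
  set S := IntermediateField.adjoin K
    (Set.range (Sum.elim w fun g : G => isotypicVar (1 : H →* Kˣ) g))
  have hle : IntermediateField.adjoin K (Set.range w) ≤ S :=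
    IntermediateField.adjoin.mono _ _ _ (by
      rintro _ ⟨i, rfl⟩
      exact ⟨Sum.inl i, rfl⟩)
  have h1 (g : G) : isotypicVar (1 : H →* Kˣ) g ∈ S :=
    IntermediateField.subset_adjoin _ _ ⟨Sum.inr g, rfl⟩
  by_cases hχ : χ = 1
  · exact hχ ▸ isAlgebraic_of_mem (h1 g)
  -- Interpolation applies to any intermediate field, here to the elements algebraic over `S`.
  let T := (algebraicClosure S (RegularFunctionField K (H × G))).restrictScalars K
  have hT : isotypicVar χ g ∈ T := by
    refine isotypicVar_mem hH T (fun g => ?_) χ (fun i => ?_) g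
    · exact mem_algebraicClosure_iff.mpr (isAlgebraic_of_mem (h1 g))
    · refine mem_algebraicClosure_iff.mpr ?_
      let _ : Algebra (IntermediateField.adjoin K (Set.range w)) S :=
        (IntermediateField.inclusion hle).toRingHom.toAlgebra
      have : IsScalarTower (IntermediateField.adjoin K (Set.range w)) S
        (RegularFunctionField K (H × G)) := .of_algebraMap_eq fun _ => rfl
      exact (halg (⟨χ, hχ⟩, i)).tower_top S
  exact mem_algebraicClosure_iff.mp hT

/-- Needed for exponents in ℤ to add. The coordinates belong to an algebraically independent family.
-/
theorem weightCoord_ne_zero [HasEnoughRootsOfUnity K (Monoid.exponent H)]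
    (hH : (Nat.card H : K) ≠ 0) (p : WeightIndex K H G) : weightCoord p ≠ 0 := by
  have := finite_weightIndex (K := K) (H := H) (G := G)
  exact (algebraicIndependent_sumElim hH weightCoord le_rfl fun p =>
    isAlgebraic_of_mem (IntermediateField.subset_adjoin _ _ ⟨p, rfl⟩)).ne_zero (Sum.inl p)

variable [Group G]

theorem regularAction_weightedPowerSum (χ : H →* Kˣ) (i : ℕ) (γ : H × G) :
    regularAction K (H × G) γ (weightedPowerSum χ i) =
      algebraMap K _ (χ γ.1) * weightedPowerSum χ i := by
  simp only [weightedPowerSum, map_sum, map_mul, map_pow, regularAction_isotypicVar,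
    Finset.mul_sum]
  refine Fintype.sum_equiv (Equiv.mulLeft γ.2) _ _ fun g => ?_
  simp [mul_assoc]

end

/-! ### Invariant Laurent monomials -/

noncomputable section

variable {K : Type*} [Field K] {H : Type*} [CommGroup H] {G : Type*}
  [Fintype G] [Fintype (WeightIndex K H G)]

/-- The character by which `H` acts on a Laurent monomial. -/
def weightChar (c : WeightIndex K H G → ℤ) : H →* Kˣ where
  toFun h := ∏ p, p.1.1 h ^ c p
  map_one' := by simp
  map_mul' h k := by simp [mul_zpow, Finset.prod_mul_distrib]

theorem weightChar_apply (c : WeightIndex K H G → ℤ) (h : H) :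
    weightChar c h = ∏ p, p.1.1 h ^ c p := rfl

theorem weightChar_single [DecidableEq (WeightIndex K H G)] (p : WeightIndex K H G) (n : ℤ)
    (h : H) : weightChar (Pi.single p n) h = p.1.1 h ^ n := by
  rw [weightChar_apply, Finset.prod_eq_single p]
  · simp
  · intro q _ hq
    simp [hq]
  · simp

variable (K H G) in
/-- The exponents of the invariant Laurent monomials. -/
def invariantExponents : AddSubgroup (WeightIndex K H G → ℤ) where
  carrier := {c | ∀ h, weightChar c h = 1}
  zero_mem' h := by simp [weightChar_apply]
  add_mem' {c d} hc hd h := by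
    have := congrArg₂ (· * ·) (hc h) (hd h)
    simpa [weightChar_apply, zpow_add, Finset.prod_mul_distrib] using this
  neg_mem' {c} hc h := by
    simpa [weightChar_apply] using hc h

theorem mem_invariantExponents {c : WeightIndex K H G → ℤ} :
    c ∈ invariantExponents K H G ↔ weightChar c = 1 :=
  (DFunLike.ext_iff (f := weightChar c) (g := 1)).symm

theorem single_exponent_mem_invariantExponents [DecidableEq (WeightIndex K H G)]
    (p : WeightIndex K H G) :
    Pi.single p (Monoid.exponent H : ℤ) ∈ invariantExponents K H G := by
  intro h
  rw [weightChar_single, zpow_natCast, ← map_pow, Monoid.pow_exponent_eq_one, map_one]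

variable [Fintype H]

/-- The Laurent monomials in the weight coordinates. -/
def weightMonomial (c : WeightIndex K H G → ℤ) : RegularFunctionField K (H × G) :=
  ∏ p, weightCoord p ^ c p

theorem weightMonomial_zero : weightMonomial (0 : WeightIndex K H G → ℤ) = 1 := by
  simp [weightMonomial]

theorem weightMonomial_single [DecidableEq (WeightIndex K H G)] (p : WeightIndex K H G) (n : ℤ) :
    weightMonomial (Pi.single p n) = weightCoord p ^ n := by
  rw [weightMonomial, Finset.prod_eq_single p]
  · simp
  · intro q _ hq
    simp [hq]
  · simp

theorem weightMonomial_neg (c : WeightIndex K H G → ℤ) :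
    weightMonomial (-c) = (weightMonomial c)⁻¹ := by
  simp [weightMonomial]

/-- If `L` is generated as a field over `S` by algebraic elements, then it is spanned by any
multiplicative set containing them. -/
theorem mem_span_of_isAlgebraic {F L : Type*} [Field F] [Field L] [Algebra F L]
    {S : IntermediateField F L} {X : Set L} (halg : ∀ x ∈ X, IsAlgebraic S x)
    (hX : ∀ T : IntermediateField F L, X ⊆ T → T = ⊤) {M : Submonoid L} (hXM : X ⊆ M) (f : L) :
    f ∈ Submodule.span S (M : Set L) := by
  have htop := hX ((IntermediateField.adjoin S X).restrictScalars F)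
    (IntermediateField.subset_adjoin S X)
  have hf : f ∈ (IntermediateField.adjoin S X).toSubalgebra := by
    have : f ∈ (IntermediateField.adjoin S X).restrictScalars F :=
      htop ▸ IntermediateField.mem_top
    exact this
  rw [IntermediateField.adjoin_toSubalgebra_of_isAlgebraic halg, ← Subalgebra.mem_toSubmodule,
    Algebra.adjoin_eq_span] at hf
  exact Submodule.span_mono (Submonoid.closure_le.mpr hXM) hf

/-- Subgroups of ℤ^ι are free of rank at most |ι|. The upper bound suffices, since the counting
criterion for independence asks only for an inequality. -/
theorem exists_closure_range_eq {ι : Type*} [Finite ι] (Λ : AddSubgroup (ι → ℤ)) :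
    ∃ n ≤ Nat.card ι, ∃ b : Fin n → ι → ℤ, AddSubgroup.closure (Set.range b) = Λ := by
  cases nonempty_fintype ι
  obtain ⟨n, b⟩ := Submodule.basisOfPid (Pi.basisFun ℤ ι) (AddSubgroup.toIntSubmodule Λ)
  refine ⟨n, ?_, fun i => b i, ?_⟩
  · have := Submodule.finrank_le (AddSubgroup.toIntSubmodule Λ)
    rwa [Module.finrank_eq_card_basis b, Module.finrank_fintype_fun_eq_card, Fintype.card_fin,
      ← Nat.card_eq_fintype_card] at this
  · apply AddSubgroup.toIntSubmodule.injective
    rw [← Submodule.span_int_eq_addSubgroupClosure]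
    have := congrArg (Submodule.map (AddSubgroup.toIntSubmodule Λ).subtype) b.span_eq
    rw [Submodule.map_span, Submodule.map_subtype_top, ← Set.range_comp] at this
    exact this

/-- The power of a coordinate with exponent `Monoid.exponent H` is an invariant monomial. -/
theorem isAlgebraic_weightCoord {S : IntermediateField K (RegularFunctionField K (H × G))}
    (hS : ∀ c ∈ invariantExponents K H G, weightMonomial c ∈ S) (p : WeightIndex K H G) :
    IsAlgebraic S (weightCoord p) := by
  classical
  refine IsAlgebraic.of_pow (n := Monoid.exponent H)
    (Nat.pos_of_ne_zero Monoid.exponent_ne_zero_of_finite) ?_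
  have := hS _ (single_exponent_mem_invariantExponents p)
  rw [weightMonomial_single, zpow_natCast] at this
  exact isAlgebraic_of_mem this

theorem weightMonomial_add [HasEnoughRootsOfUnity K (Monoid.exponent H)]
    (hH : (Nat.card H : K) ≠ 0) (c d : WeightIndex K H G → ℤ) :
    weightMonomial (c + d) = weightMonomial c * weightMonomial d := by
  simp only [weightMonomial, Pi.add_apply, ← Finset.prod_mul_distrib,
    zpow_add₀ (weightCoord_ne_zero hH _)]

theorem weightMonomial_mem [HasEnoughRootsOfUnity K (Monoid.exponent H)]
    (hH : (Nat.card H : K) ≠ 0) (S : IntermediateField K (RegularFunctionField K (H × G)))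
    {B : Set (WeightIndex K H G → ℤ)} (hB : ∀ b ∈ B, weightMonomial b ∈ S)
    {c : WeightIndex K H G → ℤ} (hc : c ∈ AddSubgroup.closure B) : weightMonomial c ∈ S := by
  induction hc using AddSubgroup.closure_induction with
  | mem x hx => exact hB x hx
  | zero => rw [weightMonomial_zero]; exact one_mem S
  | add x y _ _ hx hy => rw [weightMonomial_add hH]; exact mul_mem hx hy
  | neg x _ hx => rw [weightMonomial_neg]; exact inv_mem hx

variable [Group G]

theorem regularAction_weightMonomial (c : WeightIndex K H G → ℤ) (γ : H × G) :
    regularAction K (H × G) γ (weightMonomial c) =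
      algebraMap K _ (weightChar c γ.1) * weightMonomial c := by
  have (p : WeightIndex K H G) : regularAction K (H × G) γ (weightCoord p) =
      algebraMap K _ (p.1.1 γ.1) * weightCoord p :=
    regularAction_weightedPowerSum _ _ _
  simp only [weightMonomial, map_prod, map_zpow₀, this, mul_zpow, Finset.prod_mul_distrib,
    weightChar_apply, Units.coe_prod, Units.val_zpow_eq_zpow_val]

/-! ### The trace and the fixed field -/

theorem isIntegral_noetherField (K : Type*) [Field K] (G : Type*) [Group G] [Finite G] :
    Algebra.IsIntegral (noetherField K G) (RegularFunctionField K G) := by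
  let _ : MulSemiringAction G (RegularFunctionField K G) :=
    MulSemiringAction.compHom _ (regularAction K G)
  have : Algebra.IsInvariant (noetherField K G) (RegularFunctionField K G) G :=
    ⟨fun b hb => ⟨⟨b, (mem_noetherField_iff K G b).mpr hb⟩, rfl⟩⟩
  exact Algebra.IsInvariant.isIntegral _ _ G

/-- The sum over the group of the conjugates of a function. -/
def orbitSum {Γ : Type*} [Group Γ] [Fintype Γ] : RegularFunctionField K Γ →ₗ[K]
    RegularFunctionField K Γ :=
  ∑ γ, ((regularAction K Γ γ).toLinearMap)

theorem orbitSum_apply {Γ : Type*} [Group Γ] [Fintype Γ] (f : RegularFunctionField K Γ) :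
    orbitSum f = ∑ γ, regularAction K Γ γ f := by
  simp [orbitSum]

theorem orbitSum_mem {Γ : Type*} [Group Γ] [Fintype Γ] (f : RegularFunctionField K Γ) :
    orbitSum f ∈ noetherField K Γ := by
  rw [mem_noetherField_iff]
  intro γ
  rw [orbitSum_apply, map_sum]
  refine Fintype.sum_equiv (Equiv.mulLeft γ) _ _ fun δ => ?_
  rw [Equiv.coe_mulLeft, map_mul]
  rfl

theorem orbitSum_mul {Γ : Type*} [Group Γ] [Fintype Γ] {s : RegularFunctionField K Γ}
    (hs : s ∈ noetherField K Γ) (f : RegularFunctionField K Γ) :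
    orbitSum (s * f) = s * orbitSum f := by
  rw [mem_noetherField_iff] at hs
  simp only [orbitSum_apply, map_mul, hs, Finset.mul_sum]

/-- The trace to the fixed field is surjective. -/
theorem exists_orbitSum_eq_one (K : Type*) [Field K] (Γ : Type*) [Group Γ] [Fintype Γ] :
    ∃ m : RegularFunctionField K Γ, orbitSum m = 1 := by
  suffices ∃ m : RegularFunctionField K Γ, orbitSum m ≠ 0 by
    obtain ⟨m, hm⟩ := this
    refine ⟨(orbitSum m)⁻¹ * m, ?_⟩
    rw [orbitSum_mul (inv_mem (orbitSum_mem m)), inv_mul_cancel₀ hm]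
  by_contra! h0
  have hinj : Function.Injective (ratVar K : Γ → RegularFunctionField K Γ) :=
    (isTranscendenceBasis_ratVar K Γ).1.injective
  obtain ⟨c, hc⟩ := exists_interpolation (ratVar K : Γ → RegularFunctionField K Γ) hinj
  -- The power sums of the variables are the orbit sums of powers of x(1); if they all vanished,
  -- interpolating the constant 1 would give 1 = 0. Unlike division by |Γ|, this works in every
  -- characteristic.
  have h1 := hc (RegularFunctionField K Γ) (fun _ => 1) 1
  refine one_ne_zero (h1.trans (Finset.sum_eq_zero fun i _ => ?_))
  have := h0 (ratVar K 1 ^ (i : ℕ))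
  simp only [orbitSum_apply, map_pow, regularAction_ratVar, mul_one] at this
  simp [this]

/-- `G` moves only the factor `φ a` and `H` only scales the monomial, so the double sum factors. The
character sum vanishes unless the monomial is invariant. -/
theorem orbitSum_algHom_mul_weightMonomial
    {φ : RegularFunctionField K G →ₐ[K] RegularFunctionField K (H × G)}
    (hφ : ∀ g, φ (ratVar K g) = isotypicVar 1 g) (a : RegularFunctionField K G)
    (c : WeightIndex K H G → ℤ) :
    orbitSum (φ a * weightMonomial c) =
      algebraMap K _ (∑ h, (weightChar c h : K)) *
        φ (orbitSum a) * weightMonomial c := by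
  simp only [orbitSum_apply, map_mul, regularAction_algHom hφ, regularAction_weightMonomial,
    map_sum, Finset.sum_mul_sum, Fintype.sum_prod_type]
  rw [Finset.sum_mul]
  refine Finset.sum_congr rfl fun h _ => ?_
  rw [Finset.sum_mul]
  exact Finset.sum_congr rfl fun g _ => by rw [← mul_assoc, mul_comm (φ _)]

/-- The image of `φ` and the coordinates generate the field and are algebraic over `S`, so no
denominators are needed: the products, being closed under multiplication, already span. -/
theorem mem_span_algHom_mul_weightMonomial [HasEnoughRootsOfUnity K (Monoid.exponent H)]
    (hH : (Nat.card H : K) ≠ 0)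
    {φ : RegularFunctionField K G →ₐ[K] RegularFunctionField K (H × G)}
    (hφ : ∀ g, φ (ratVar K g) = isotypicVar 1 g)
    {S : IntermediateField K (RegularFunctionField K (H × G))}
    (hSφ : ∀ a ∈ noetherField K G, φ a ∈ S)
    (hS : ∀ c ∈ invariantExponents K H G, weightMonomial c ∈ S)
    (f : RegularFunctionField K (H × G)) :
    f ∈ Submodule.span S (Set.range fun q : RegularFunctionField K G × (WeightIndex K H G → ℤ) =>
      φ q.1 * weightMonomial q.2) := by
  classical
  let M : Submonoid (RegularFunctionField K (H × G)) :=
    { carrier := Set.range fun q : RegularFunctionField K G × (WeightIndex K H G → ℤ) =>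
        φ q.1 * weightMonomial q.2
      one_mem' := ⟨(1, 0), by simp [weightMonomial_zero]⟩
      mul_mem' := by
        rintro _ _ ⟨q, rfl⟩ ⟨r, rfl⟩
        refine ⟨(q.1 * r.1, q.2 + r.2), ?_⟩
        simp only [map_mul, weightMonomial_add hH]
        ring }
  have hφalg (a : RegularFunctionField K G) : IsAlgebraic S (φ a) := by
    have ha := (isIntegral_noetherField K G).isIntegral a
    let ψ : noetherField K G →+* S :=
      (φ.toRingHom.comp (algebraMap (noetherField K G) _)).codRestrict S
        fun a => hSφ _ a.2
    exact (ha.map_of_comp_eq ψ φ.toRingHom rfl).isAlgebraic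
  refine mem_span_of_isAlgebraic (M := M)
    (X := Set.range φ ∪ Set.range (weightCoord : WeightIndex K H G → _)) ?_ ?_ ?_ f
  · rintro _ (⟨a, rfl⟩ | ⟨p, rfl⟩)
    · exact hφalg a
    · exact isAlgebraic_weightCoord hS p
  · intro T hT
    refine eq_top_of_weightCoord_mem hH T (fun g => ?_) (fun p => hT (Or.inr ⟨p, rfl⟩))
    rw [← hφ]
    exact hT (Or.inl ⟨ratVar K g, rfl⟩)
  · rintro _ (⟨a, rfl⟩ | ⟨p, rfl⟩)
    · exact ⟨(a, 0), by simp [weightMonomial_zero]⟩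
    · exact ⟨(1, Pi.single p 1), by simp [weightMonomial_single]⟩

/-- The trace is `S`-linear and maps the spanning products into `S`. If m has trace 1, an invariant
f is the trace of f m, hence lies in `S`. -/
theorem noetherField_le [HasEnoughRootsOfUnity K (Monoid.exponent H)]
    (hH : (Nat.card H : K) ≠ 0)
    {φ : RegularFunctionField K G →ₐ[K] RegularFunctionField K (H × G)}
    (hφ : ∀ g, φ (ratVar K g) = isotypicVar 1 g)
    {S : IntermediateField K (RegularFunctionField K (H × G))}
    (hSle : S ≤ noetherField K (H × G))
    (hSφ : ∀ a ∈ noetherField K G, φ a ∈ S)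
    (hS : ∀ c ∈ invariantExponents K H G, weightMonomial c ∈ S) :
    noetherField K (H × G) ≤ S := by
  have key (f : RegularFunctionField K (H × G)) : orbitSum f ∈ S := by
    induction mem_span_algHom_mul_weightMonomial hH hφ hSφ hS f using
      Submodule.span_induction with
    | mem x hx =>
      obtain ⟨⟨a, c⟩, rfl⟩ := hx
      rw [orbitSum_algHom_mul_weightMonomial hφ]
      by_cases hc : c ∈ invariantExponents K H G
      · exact mul_mem (mul_mem (S.algebraMap_mem _) (hSφ _ (orbitSum_mem a))) (hS c hc)
      · rw [sum_character_eq_zero (mt mem_invariantExponents.mpr hc), map_zero, zero_mul, zero_mul]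
        exact zero_mem S
    | zero => rw [map_zero]; exact zero_mem S
    | add x y _ _ hx hy => rw [map_add]; exact add_mem hx hy
    | smul s x _ hx =>
      rw [Algebra.smul_def]
      change orbitSum ((s : RegularFunctionField K (H × G)) * x) ∈ S
      rw [orbitSum_mul (hSle s.2)]
      exact mul_mem s.2 hx
  intro f hf
  obtain ⟨m, hm⟩ := exists_orbitSum_eq_one K (H × G)
  have := key (f * m)
  rwa [orbitSum_mul hf, hm, mul_one] at this

end

/-! ### Rationality over K(G) -/

/-- A criterion for rationality of `E` over `F`, tested after embedding `E` in a larger field. -/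
theorem isRationalAlong_of_embedding {F E R L : Type*} [Field F] [Field E] [Field R] [Field L]
    [Algebra R L] (φ : F →+* E) (ι : E →+* L) (σ : F →+* R)
    (hσ : ∀ a, algebraMap R L (σ a) = ι (φ a)) {n : ℕ} (x : Fin n → E)
    (hx : AlgebraicIndependent R (ι ∘ x))
    (hgen : ∀ T : Subfield L, (∀ a, ι (φ a) ∈ T) → (∀ j, ι (x j) ∈ T) → ∀ e, ι e ∈ T) :
    IsRationalAlong φ := by
  let _ : Algebra F E := φ.toAlgebra
  refine ⟨n, x, ?_, ?_⟩
  · let _ : Algebra F R := σ.toAlgebra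
    let _ : Algebra F L := (ι.comp φ).toAlgebra
    have : IsScalarTower F R L := .of_algebraMap_eq fun a => (hσ a).symm
    let ι' : E →ₐ[F] L := { ι with commutes' := fun _ => rfl }
    exact AlgebraicIndependent.of_comp ι' (hx.restrictScalars σ.injective)
  · refine eq_top_iff.mpr fun e _ => ?_
    have he := hgen ((IntermediateField.adjoin F (Set.range x)).toSubfield.map ι)
      (fun a => ⟨φ a, IntermediateField.algebraMap_mem _ a, rfl⟩)
      (fun j => ⟨x j, IntermediateField.subset_adjoin _ _ ⟨j, rfl⟩, rfl⟩) e
    obtain ⟨e', he', heq⟩ := he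
    rw [← ι.injective heq]
    exact he'

theorem theorem1p1 (K : Type*) [Field K] (H : Type*) [CommGroup H] [Finite H]
    (G : Type*) [Group G] [Finite G] (e : ℕ) (he : Monoid.exponent H = e)
    (hK : ∃ ζ : K, IsPrimitiveRoot ζ e) :
    ∃ φ : noetherField K G →ₐ[K] noetherField K (H × G),
      Function.Injective φ ∧ IsRationalAlong φ.toRingHom := by
  subst he
  cases nonempty_fintype H
  cases nonempty_fintype G
  have hH := natCast_card_ne_zero H hK
  have := hasEnoughRootsOfUnity_exponent H hK
  have := finite_weightIndex (K := K) (H := H) (G := G)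
  cases nonempty_fintype (WeightIndex K H G)
  obtain ⟨φ, hφ⟩ := exists_algHom_isotypicVar_one (K := K) (H := H) (G := G) hH
  have hφmem (a : noetherField K G) : φ a ∈ noetherField K (H × G) := by
    rw [mem_noetherField_iff]
    intro γ
    rw [regularAction_algHom hφ, (mem_noetherField_iff K G _).mp a.2]
  let ψ : noetherField K G →ₐ[K] noetherField K (H × G) :=
    (φ.comp (noetherField K G).val).codRestrict (noetherField K (H × G)).toSubalgebra hφmem
  obtain ⟨n, hn, b, hb⟩ := exists_closure_range_eq (invariantExponents K H G)
  have hinv (c) (hc : c ∈ invariantExponents K H G) :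
      weightMonomial c ∈ noetherField K (H × G) := by
    rw [mem_noetherField_iff]
    intro γ
    rw [regularAction_weightMonomial, hc, Units.val_one, map_one, one_mul]
  have hbmem (j : Fin n) : b j ∈ invariantExponents K H G :=
    hb ▸ AddSubgroup.subset_closure ⟨j, rfl⟩
  have hmem (T : IntermediateField K (RegularFunctionField K (H × G)))
      (hT : ∀ j, weightMonomial (b j) ∈ T) (c) (hc : c ∈ invariantExponents K H G) :
      weightMonomial c ∈ T := by
    rw [← hb] at hc
    refine weightMonomial_mem hH T ?_ hc
    rintro _ ⟨j, rfl⟩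
    exact hT j
  refine ⟨ψ, ψ.injective, ?_⟩
  have hbalg := isAlgebraic_weightCoord
    (hmem (IntermediateField.adjoin K (Set.range fun j => weightMonomial (b j))) fun j =>
      IntermediateField.subset_adjoin _ _ ⟨j, rfl⟩)
  have hind := algebraicIndependent_sumElim hH (fun j => weightMonomial (b j))
    (by rwa [Nat.card_fin]) hbalg
  -- Joint independence over `K` becomes independence of the monomials over the field generated by
  -- the y_1(g), which contains the image of K(G).
  rw [AlgebraicIndependent.sumElim_iff, ← IntermediateField.algebraicIndependent_adjoin_iff]
    at hind
  set R := IntermediateField.adjoin K (Set.range fun g : G => isotypicVar (1 : H →* Kˣ) g)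
  have hR (a : RegularFunctionField K G) : φ a ∈ R := by
    have : R.comap φ = ⊤ := regularFunctionField_induction _ fun g => by
      change φ (ratVar K g) ∈ R
      rw [hφ]
      exact IntermediateField.subset_adjoin _ _ ⟨g, rfl⟩
    have ha : a ∈ R.comap φ := this ▸ IntermediateField.mem_top
    exact ha
  refine isRationalAlong_of_embedding ψ.toRingHom
    (algebraMap (noetherField K (H × G)) (RegularFunctionField K (H × G)))
    ((φ.toRingHom.comp (algebraMap (noetherField K G) _)).codRestrict R fun a => hR a)
    (fun _ => rfl) (fun j => ⟨weightMonomial (b j), hinv _ (hbmem j)⟩) hind.2 ?_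
  intro T hTφ hTw f
  let S := IntermediateField.adjoin K
    (φ '' noetherField K G ∪ Set.range fun j => weightMonomial (b j))
  have hSφ (a) (ha : a ∈ noetherField K G) : φ a ∈ S :=
    IntermediateField.subset_adjoin _ _ (Or.inl ⟨a, ha, rfl⟩)
  have hSle : S ≤ noetherField K (H × G) := by
    rw [IntermediateField.adjoin_le_iff]
    rintro _ (⟨a, ha, rfl⟩ | ⟨j, rfl⟩)
    · exact hφmem ⟨a, ha⟩
    · exact hinv _ (hbmem j)
  have hf := noetherField_le hH hφ hSle hSφ
    (hmem S fun j => IntermediateField.subset_adjoin _ _ (Or.inr ⟨j, rfl⟩)) f.2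
  -- `T` contains the image of K(G), hence the constants.
  let T' : IntermediateField K (RegularFunctionField K (H × G)) :=
    { T with
      algebraMap_mem' := fun r => by
        have := hTφ (algebraMap K _ r)
        rwa [show ψ.toRingHom (algebraMap K _ r) = algebraMap K _ r from ψ.commutes r] at this }
  have hST : S ≤ T' := by
    rw [IntermediateField.adjoin_le_iff]
    rintro _ (⟨a, ha, rfl⟩ | ⟨j, rfl⟩)
    · exact hTφ ⟨a, ha⟩
    · exact hTw j
  exact hST hf
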